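/- A \emph{2-colored graph} is a triple $H=(V,E_r,E_b)$ with $V$ a finite vertex set and $E_r,E_b\subseteq\binom{V}{2}$ its sets of red and blue edges, which need not be disjoint. A 2-colored graph $G$ \emph{contains} $H$ if there is an injection $V(H)\to V(G)$ that maps red edges of $H$ to red edges of $G$ and blue edges of $H$ to blue edges of $G$; otherwise $G$ is \emph{$H$-free}. $H$ is \emph{bipartite} if it contains no odd cycle of length at least $3$ all of whose edges have the same color. For $G$ on $n$ vertices put $h_n(G)=(|E_r(G)|+|E_b(G)|)/\binom{n}{2}$, let $\pi_n(H)$ be the maximum of $h_n(G)$ over all $H$-free 2-colored graphs $G$ on $n$ vertices, and let $\pi(H)=\lim_{n\to\infty}\pi_n(H)$ be the Tur\'an density of $H$. Let $H$ be a 2-colored graph with at least one edge. Then the limit $\pi(H)$ exists, and \begin{enumerate} \item if $H$ is not bipartite, then $\pi(H)\ge \frac32$; \item if $H$ is bipartite, then $\pi(H)\le \frac32$. \end{enumerate} -/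

import Mathlib

/-- A 2-edge-colored graph `(V, E_r, E_b)`: two simple graphs (red and blue edges) on the same
vertex set, not necessarily edge-disjoint. -/
structure TwoColoredGraph (V : Type*) where
  /-- the graph of red edges -/
  red : SimpleGraph V
  /-- the graph of blue edges -/
  blue : SimpleGraph V

namespace TwoColoredGraph

/-- `H` is (isomorphic to) a sub-graph of `G`: there is an injection of vertices under which
red edges go to red edges and blue edges go to blue edges. -/
def IsContained {V W : Type*} (H : TwoColoredGraph V) (G : TwoColoredGraph W) : Prop :=
  ∃ f : V ↪ W, (∀ u v, H.red.Adj u v → G.red.Adj (f u) (f v)) ∧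
    (∀ u v, H.blue.Adj u v → G.blue.Adj (f u) (f v))

/-- `H` contains no odd cycle all of whose edges have the same color. (Cycles of a simple graph
have length at least `3` by definition.) -/
def IsBipartite {V : Type*} (H : TwoColoredGraph V) : Prop :=
  (∀ (v : V) (c : H.red.Walk v v), c.IsCycle → ¬ Odd c.length) ∧
    (∀ (v : V) (c : H.blue.Walk v v), c.IsCycle → ¬ Odd c.length)

/-- The edge density `h_n(G) = (|E_r| + |E_b|) / (n choose 2)` of a graph on `n` vertices. -/
noncomputable def edgeDensity {V : Type*} (G : TwoColoredGraph V) : ℝ :=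
  ((G.red.edgeSet.ncard : ℝ) + (G.blue.edgeSet.ncard : ℝ)) / ((Nat.card V).choose 2 : ℝ)

/-- `π_n(H)`: the maximum of `h_n(G)` over the 2-colored graphs `G` on `n` vertices that do not
contain `H`. The set below is finite, and it contains the density `0` of the edgeless graph as
soon as `H` has an edge, so that the supremum is then a maximum. -/
noncomputable def turanDensityAt {V : Type*} (H : TwoColoredGraph V) (n : ℕ) : ℝ :=
  sSup {x : ℝ | ∃ G : TwoColoredGraph (Fin n), ¬ H.IsContained G ∧ G.edgeDensity = x}

/-- The Turán density `π(H) = lim_{n → ∞} π_n(H)`. -/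
noncomputable def turanDensity {V : Type*} (H : TwoColoredGraph V) : ℝ :=
  Filter.limUnder Filter.atTop H.turanDensityAt

end TwoColoredGraph

/-! Averaging over vertex-deleted subgraphs shows that the densities decrease with n, so the limit
exists. Lower bound: if `H` has a monochromatic odd cycle, make that color a balanced complete
bipartite graph and the other color complete. The result is `H`-free and has density at least 3/2.

Upper bound: if `H` is bipartite, a 2-coloring of each color graph splits its vertices into four
classes, so `H` sits in a blow-up of the four-vertex pattern `IsGrid`. It remains to find this
blow-up at every density above 3/2. A graph without a grid has at most 3/4 * n ^ 2 edges
(`sum_weight_le_of_forall_not_isGrid`). Averaging over samples of bounded size turns this into a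
positive proportion of grids (`exists_mul_pow_le_card_isGrid`). Kővári–Sós–Turán style double
counting (`exists_embedding_forall_of_dense`), one coordinate at a time, then yields the blow-up. -/

namespace SimpleGraph

/-! ### Graphs without odd cycles are 2-colorable. -/

variable {V : Type*} {G : SimpleGraph V}

/-- If all cycles are even, every walk can be replaced by a path of the same parity. -/
theorem Walk.exists_isPath_even_iff
    (hG : ∀ (v : V) (c : G.Walk v v), c.IsCycle → ¬ Odd c.length) {u v : V} (p : G.Walk u v) :
    ∃ q : G.Walk u v, q.IsPath ∧ (Even q.length ↔ Even p.length) := by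
  classical
  induction p with
  | nil => exact ⟨Walk.nil, Walk.IsPath.nil, Iff.rfl⟩
  | @cons u x v h p ih =>
    obtain ⟨q, hq, hpar⟩ := ih
    by_cases hu : u ∈ q.support
    · refine ⟨q.dropUntil u hu, hq.dropUntil hu, ?_⟩
      have hlen : (q.takeUntil u hu).length + (q.dropUntil u hu).length = q.length := by
        rw [← Walk.length_append, Walk.take_spec]
      -- The piece from `x` back to `u` is either the edge itself or closes up with it to a cycle,
      -- which is even. With the new edge it forms an even detour, so cutting it out keeps the
      -- parity.
      have hodd : Odd (q.takeUntil u hu).length := by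
        by_cases he : s(u, x) ∈ (q.takeUntil u hu).edges
        · rw [(hq.takeUntil hu).length_eq_one_of_mem_edges (by rwa [Sym2.eq_swap])]
          exact odd_one
        · have hc := hG u (Walk.cons h (q.takeUntil u hu))
            ((Walk.cons_isCycle_iff _ h).2 ⟨hq.takeUntil hu, he⟩)
          rw [Walk.length_cons] at hc
          grind
      rw [Walk.length_cons]
      grind
    · refine ⟨Walk.cons h q, (Walk.cons_isPath_iff h q).2 ⟨hq, hu⟩, ?_⟩
      simp only [Walk.length_cons, Nat.even_add_one, hpar]

/-- A graph without odd cycles is bipartite. -/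
theorem colorable_two_of_forall_isCycle_not_odd
    (hG : ∀ (v : V) (c : G.Walk v v), c.IsCycle → ¬ Odd c.length) : G.Colorable 2 := by
  rw [two_colorable_iff_forall_loop_even]
  intro u w
  obtain ⟨q, hq, hpar⟩ := w.exists_isPath_even_iff hG
  rw [← hpar, (Walk.isPath_iff_nil.1 hq).eq_nil]
  simp

end SimpleGraph

/-! ### Densities as sums of weights over ordered pairs. -/

namespace TwoColoredGraph

open scoped Classical in
/-- The number of colors of the edges joining two vertices. -/
noncomputable def weight {V : Type*} (G : TwoColoredGraph V) (u v : V) : ℝ :=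
  (if G.red.Adj u v then 1 else 0) + (if G.blue.Adj u v then 1 else 0)

section weight

variable {V : Type*} (G : TwoColoredGraph V)

theorem weight_nonneg (u v : V) : 0 ≤ G.weight u v := by
  unfold weight
  split_ifs <;> norm_num

theorem weight_le_two (u v : V) : G.weight u v ≤ 2 := by
  unfold weight
  split_ifs <;> norm_num

@[simp]
theorem weight_self (u : V) : G.weight u u = 0 := by
  simp [weight]

theorem weight_comm (u v : V) : G.weight u v = G.weight v u := by
  unfold weight
  congr 2 <;> exact propext (SimpleGraph.adj_comm _ _ _)

theorem edgeDensity_eq_sum_weight [Fintype V] :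
    G.edgeDensity =
      (∑ u, ∑ v, G.weight u v) / ((Fintype.card V : ℝ) * ((Fintype.card V : ℝ) - 1)) := by
  classical
  have key : ∀ K : SimpleGraph V,
      ∑ u, ∑ v, (if K.Adj u v then (1 : ℝ) else 0) = 2 * K.edgeSet.ncard := by
    intro K
    have h := K.sum_degrees_eq_twice_card_edges
    rw [← SimpleGraph.coe_edgeFinset, Set.ncard_coe_finset]
    have h' : ((∑ v, K.degree v : ℕ) : ℝ) = 2 * (K.edgeFinset.card : ℝ) := by
      rw [h]; push_cast; rfl
    rw [← h']
    push_cast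
    refine Finset.sum_congr rfl fun u _ => ?_
    rw [Finset.sum_boole, ← SimpleGraph.card_neighborFinset_eq_degree,
      SimpleGraph.neighborFinset_eq_filter]
  have hsum : ∑ u, ∑ v, G.weight u v
      = 2 * ((G.red.edgeSet.ncard : ℝ) + (G.blue.edgeSet.ncard : ℝ)) := by
    rw [mul_add, ← key, ← key, ← Finset.sum_add_distrib]
    refine Finset.sum_congr rfl fun u _ => ?_
    rw [← Finset.sum_add_distrib]
    rfl
  rw [hsum, edgeDensity, Nat.card_eq_fintype_card, Nat.cast_choose_two, div_div_eq_mul_div,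
    mul_comm]

theorem edgeDensity_nonneg : 0 ≤ G.edgeDensity := by
  unfold edgeDensity
  positivity

theorem edgeDensity_le_two [Finite V] : G.edgeDensity ≤ 2 := by
  classical
  have := Fintype.ofFinite V
  have key : ∀ K : SimpleGraph V, (K.edgeSet.ncard : ℝ) ≤ ((Fintype.card V).choose 2 : ℝ) := by
    intro K
    rw [← SimpleGraph.coe_edgeFinset, Set.ncard_coe_finset]
    exact_mod_cast K.card_edgeFinset_le_card_choose_two
  unfold edgeDensity
  rw [Nat.card_eq_fintype_card]
  apply div_le_of_le_mul₀ (by positivity) (by norm_num)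
  linarith [key G.red, key G.blue]

/-- Pull a 2-colored graph back along a map of vertices. -/
def comap {W : Type*} (f : W → V) : TwoColoredGraph W :=
  ⟨G.red.comap f, G.blue.comap f⟩

@[simp]
theorem weight_comap {W : Type*} (f : W → V) (u v : W) :
    (G.comap f).weight u v = G.weight (f u) (f v) := rfl

theorem IsContained.of_comap {U W : Type*} {H : TwoColoredGraph U} (f : W ↪ V)
    (h : H.IsContained (G.comap f)) : H.IsContained G := by
  obtain ⟨g, hr, hb⟩ := h
  exact ⟨g.trans f, hr, hb⟩

end weight

/-! ### Monotonicity and existence of the limit. -/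

section limit

variable {V : Type*} (H : TwoColoredGraph V)

theorem bddAbove_edgeDensity (n : ℕ) :
    BddAbove {x : ℝ | ∃ G : TwoColoredGraph (Fin n), ¬ H.IsContained G ∧ G.edgeDensity = x} := by
  refine ⟨2, ?_⟩
  rintro x ⟨G, -, rfl⟩
  exact G.edgeDensity_le_two

theorem edgeDensity_le_turanDensityAt {n : ℕ} {G : TwoColoredGraph (Fin n)}
    (hG : ¬ H.IsContained G) : G.edgeDensity ≤ H.turanDensityAt n :=
  le_csSup (H.bddAbove_edgeDensity n) ⟨G, hG, rfl⟩

theorem turanDensityAt_nonneg (n : ℕ) : 0 ≤ H.turanDensityAt n := by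
  apply Real.sSup_nonneg
  rintro x ⟨G, -, rfl⟩
  exact G.edgeDensity_nonneg

theorem exists_lt_edgeDensity {n : ℕ} {a : ℝ} (ha : 0 ≤ a) (h : a < H.turanDensityAt n) :
    ∃ G : TwoColoredGraph (Fin n), ¬ H.IsContained G ∧ a < G.edgeDensity := by
  by_contra! hcon
  refine absurd h (not_lt.2 (Real.sSup_le ?_ ha))
  rintro x ⟨G, hG, rfl⟩
  exact hcon G hG

/-- Averaging the total weight over the vertex-deleted subgraphs. -/
theorem sum_weight_comap_succAbove {n : ℕ} (G : TwoColoredGraph (Fin (n + 1))) :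
    ∑ v : Fin (n + 1), ∑ i, ∑ j, (G.comap v.succAbove).weight i j
      = ((n : ℝ) - 1) * ∑ u, ∑ v, G.weight u v := by
  have h : ∀ v : Fin (n + 1), ∑ i, ∑ j, (G.comap v.succAbove).weight i j
      = ∑ u, ∑ w, G.weight u w - 2 * ∑ w, G.weight v w := by
    intro v
    have h1 := Fin.sum_univ_succAbove (fun u => ∑ w, G.weight u w) v
    have h2 : ∀ i : Fin n, ∑ j, G.weight (v.succAbove i) (v.succAbove j)
        = ∑ w, G.weight (v.succAbove i) w - G.weight v (v.succAbove i) := by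
      intro i
      rw [Fin.sum_univ_succAbove (fun w => G.weight (v.succAbove i) w) v, G.weight_comm v]
      ring
    have h3 := Fin.sum_univ_succAbove (fun w => G.weight v w) v
    simp only [weight_comap, h2, Finset.sum_sub_distrib]
    simp only [weight_self] at h3
    linarith
  simp only [h, Finset.sum_sub_distrib, ← Finset.mul_sum, Finset.sum_const, Finset.card_univ,
    Fintype.card_fin, nsmul_eq_mul]
  push_cast
  ring

/-- Deleting a vertex keeps the graph `H`-free, and each edge survives n - 1 of the n + 1 deletions.
For n ≤ 1 the density is 0 / 0 = 0 and says nothing about larger n. -/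
theorem turanDensityAt_succ_le {n : ℕ} (hn : 2 ≤ n) :
    H.turanDensityAt (n + 1) ≤ H.turanDensityAt n := by
  apply Real.sSup_le _ (H.turanDensityAt_nonneg n)
  rintro x ⟨G, hG, rfl⟩
  have hn' : (2 : ℝ) ≤ n := by exact_mod_cast hn
  have hpos : (0 : ℝ) < (n : ℝ) * ((n : ℝ) - 1) := by nlinarith
  have hdel : ∀ v : Fin (n + 1), ∑ i, ∑ j, (G.comap v.succAbove).weight i j
      ≤ H.turanDensityAt n * ((n : ℝ) * ((n : ℝ) - 1)) := by
    intro v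
    have h := H.edgeDensity_le_turanDensityAt (G := G.comap v.succAbove)
      fun hc => hG (IsContained.of_comap G v.succAboveEmb hc)
    rwa [edgeDensity_eq_sum_weight, Fintype.card_fin, div_le_iff₀ hpos] at h
  have hsum := Finset.sum_le_sum fun v (_ : v ∈ Finset.univ) => hdel v
  rw [sum_weight_comap_succAbove] at hsum
  simp only [Finset.sum_const, Finset.card_univ, Fintype.card_fin, nsmul_eq_mul] at hsum
  push_cast at hsum
  rw [edgeDensity_eq_sum_weight, Fintype.card_fin]
  push_cast
  rw [div_le_iff₀ (by nlinarith)]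
  have h1 : (0 : ℝ) < (n : ℝ) - 1 := by linarith
  nlinarith

theorem antitone_turanDensityAt : Antitone fun n => H.turanDensityAt (n + 2) :=
  antitone_nat_of_succ_le fun n => H.turanDensityAt_succ_le (by omega)

theorem tendsto_turanDensityAt :
    Filter.Tendsto H.turanDensityAt Filter.atTop (nhds H.turanDensity) := by
  have h := tendsto_atTop_ciInf H.antitone_turanDensityAt
    ⟨0, by rintro _ ⟨n, rfl⟩; exact H.turanDensityAt_nonneg _⟩
  have h' := (Filter.tendsto_add_atTop_iff_nat (f := H.turanDensityAt) 2).1 h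
  exact tendsto_nhds_limUnder ⟨_, h'⟩

theorem turanDensity_le_turanDensityAt {n : ℕ} (hn : 2 ≤ n) :
    H.turanDensity ≤ H.turanDensityAt n := by
  obtain ⟨k, rfl⟩ := Nat.exists_eq_add_of_le' hn
  exact H.antitone_turanDensityAt.le_of_tendsto
    ((Filter.tendsto_add_atTop_iff_nat 2).2 H.tendsto_turanDensityAt) k

end limit

/-! ### The lower bound for non-bipartite `H`. -/

section lower

variable {V : Type*} (H : TwoColoredGraph V)

/-- The balanced complete bipartite graph on `Fin n` with the even and the odd numbers as its
parts. -/
def parityGraph (n : ℕ) : SimpleGraph (Fin n) :=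
  (⊤ : SimpleGraph Bool).comap fun i => decide (Even (i : ℕ))

theorem not_odd_length_of_hom_parityGraph {K : SimpleGraph V} {n : ℕ} (f : V → Fin n)
    (hf : ∀ u v, K.Adj u v → (parityGraph n).Adj (f u) (f v)) {v : V} (c : K.Walk v v) :
    ¬ Odd c.length := by
  let C : K.Coloring Bool :=
    SimpleGraph.Coloring.mk (fun x => decide (Even (f x : ℕ))) fun {x y} h => hf x y h
  rw [Nat.not_odd_iff_even, C.even_length_iff_congr c]

-- Written with signs, the double sum of the red weights factors through the square of an
-- alternating sum, which is at most 1.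
open scoped Classical in
theorem weight_parityGraph {n : ℕ} (u v : Fin n) :
    (⟨parityGraph n, ⊤⟩ : TwoColoredGraph (Fin n)).weight u v
      = (1 - (-1) ^ (u : ℕ) * (-1) ^ (v : ℕ)) / 2 + (1 - if u = v then 1 else 0) := by
  unfold weight
  congr 1
  · simp only [parityGraph, SimpleGraph.comap_adj, SimpleGraph.top_adj, ne_eq, decide_eq_decide]
    rcases Nat.even_or_odd (u : ℕ) with hu | hu <;> rcases Nat.even_or_odd (v : ℕ) with hv | hv <;>
      simp [hu, hv, hu.neg_one_pow, hv.neg_one_pow, ← Nat.not_odd_iff_even]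
  · by_cases h : u = v <;> simp [h]

theorem three_halves_le_edgeDensity_parityGraph {n : ℕ} (hn : 2 ≤ n) :
    3 / 2 ≤ (⟨parityGraph n, ⊤⟩ : TwoColoredGraph (Fin n)).edgeDensity := by
  have hn' : (2 : ℝ) ≤ n := by exact_mod_cast hn
  rw [edgeDensity_eq_sum_weight, Fintype.card_fin, le_div_iff₀ (by nlinarith)]
  have hs : (∑ u : Fin n, (-1 : ℝ) ^ (u : ℕ)) ^ 2 ≤ 1 := by
    rw [Fin.sum_univ_eq_sum_range (fun i => (-1 : ℝ) ^ i) n, neg_one_geom_sum]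
    split_ifs <;> norm_num
  have hsum : ∑ u : Fin n, ∑ v : Fin n, (⟨parityGraph n, ⊤⟩ : TwoColoredGraph (Fin n)).weight u v
      = ((n : ℝ) ^ 2 - (∑ u : Fin n, (-1 : ℝ) ^ (u : ℕ)) ^ 2) / 2 + ((n : ℝ) ^ 2 - n) := by
    simp only [weight_parityGraph, Finset.sum_add_distrib, ← Finset.sum_div,
      Finset.sum_sub_distrib, ← Finset.mul_sum, ← Finset.sum_mul]
    simp
    ring
  rw [hsum]
  nlinarith

theorem edgeDensity_swap {W : Type*} (K L : SimpleGraph W) :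
    (⟨K, L⟩ : TwoColoredGraph W).edgeDensity = (⟨L, K⟩ : TwoColoredGraph W).edgeDensity := by
  simp only [edgeDensity, add_comm]

theorem three_halves_le_turanDensityAt (hH : ¬ H.IsBipartite) {n : ℕ} (hn : 2 ≤ n) :
    3 / 2 ≤ H.turanDensityAt n := by
  have hd := three_halves_le_edgeDensity_parityGraph hn
  rw [IsBipartite, not_and_or] at hH
  rcases hH with hH | hH
  · refine hd.trans (H.edgeDensity_le_turanDensityAt ?_)
    rintro ⟨f, hr, -⟩
    exact hH fun v c _ => not_odd_length_of_hom_parityGraph f hr c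
  · rw [edgeDensity_swap] at hd
    refine hd.trans (H.edgeDensity_le_turanDensityAt ?_)
    rintro ⟨f, -, hb⟩
    exact hH fun v c _ => not_odd_length_of_hom_parityGraph f hb c

theorem three_halves_le_turanDensity (hH : ¬ H.IsBipartite) : 3 / 2 ≤ H.turanDensity :=
  ge_of_tendsto H.tendsto_turanDensityAt
    ((Filter.eventually_ge_atTop 2).mono fun _ hn => H.three_halves_le_turanDensityAt hH hn)

end lower

end TwoColoredGraph

/-! ### Two general counting lemmas. -/

/-- Reindexing a sum over functions that only depends on the values at an injective family of
points. -/
theorem Fintype.card_pow_mul_sum_comp {ι κ V : Type*} [Fintype ι] [Fintype κ] [Fintype V]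
    [DecidableEq ι] [DecidableEq κ] (e : ι ↪ κ) (f : (ι → V) → ℝ) :
    (Fintype.card V : ℝ) ^ Fintype.card ι * ∑ φ : κ → V, f (φ ∘ e)
      = (Fintype.card V : ℝ) ^ Fintype.card κ * ∑ ψ : ι → V, f ψ := by
  classical
  let E : ι ⊕ {x // x ∉ Set.range e} ≃ κ :=
    (Equiv.sumCongr (Equiv.ofInjective e e.injective) (Equiv.refl _)).trans
      (Equiv.sumCompl (· ∈ Set.range e))
  have hE : ∀ i, E (Sum.inl i) = e i := fun i => rfl
  let F : (κ → V) ≃ (ι → V) × ({x // x ∉ Set.range e} → V) :=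
    (E.arrowCongr (Equiv.refl V)).symm.trans (Equiv.sumArrowEquivProdArrow _ _ _)
  have hF : ∀ φ, (F φ).1 = φ ∘ e := fun φ => rfl
  have hcard : Fintype.card κ = Fintype.card ι + Fintype.card {x // x ∉ Set.range e} := by
    rw [← Fintype.card_sum, Fintype.card_congr E]
  have hsum : ∑ φ : κ → V, f (φ ∘ e)
      = (Fintype.card V : ℝ) ^ Fintype.card {x // x ∉ Set.range e} * ∑ ψ : ι → V, f ψ := by
    simp only [← hF]
    rw [F.sum_comp (fun p => f p.1), Fintype.sum_prod_type]
    simp [Finset.mul_sum]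
  rw [hsum, hcard]
  ring

/-- A dense bipartite relation between `X` and a large set `Y` contains a complete bipartite
relation between a positive proportion of `X` and a copy of `ι` in `Y`. -/
theorem exists_embedding_forall_of_dense {ι : Type*} [Fintype ι] {c : ℝ} (hc : 0 < c) :
    ∃ c' : ℝ, 0 < c' ∧ ∃ N : ℕ, ∀ (X Y : Type) [Fintype X] [Fintype Y] (R : X → Y → Prop),
      N ≤ Fintype.card Y →
      c * Fintype.card X * Fintype.card Y ≤ (Nat.card {p : X × Y // R p.1 p.2} : ℝ) →
      ∃ g : ι ↪ Y, c' * Fintype.card X ≤ (Nat.card {x : X // ∀ i, R x (g i)} : ℝ) := by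
  classical
  set t := Fintype.card ι with ht
  -- At least c/2 of `X` has degree at least c/2 * |Y|. As t ≤ c/4 * |Y|, each such neighborhood
  -- admits at least (c/4 * |Y|) ^ t embeddings of `ι`.
  refine ⟨c / 2 * (c / 4) ^ t, by positivity, max (t + 1) ⌈4 * t / c⌉₊, ?_⟩
  intro X Y _ _ R hN hR
  have hY : (0 : ℝ) < Fintype.card Y := by
    exact_mod_cast (Nat.succ_pos t).trans_le ((le_max_left _ _).trans hN)
  have hYt : (t : ℝ) ≤ c / 4 * Fintype.card Y := by
    have h : 4 * t / c ≤ (Fintype.card Y : ℝ) :=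
      (Nat.le_ceil _).trans (by exact_mod_cast (le_max_right _ _).trans hN)
    rw [div_le_iff₀ hc] at h
    linarith
  let D : X → Finset Y := fun x => Finset.univ.filter fun y => R x y
  have hDsum : (Nat.card {p : X × Y // R p.1 p.2} : ℝ) = ∑ x, ((D x).card : ℝ) := by
    rw [Nat.card_eq_fintype_card, Fintype.card_subtype, ← Nat.cast_sum,
      Finset.card_filter, Fintype.sum_prod_type]
    simp only [D, Finset.card_filter]
  let A : Finset X := Finset.univ.filter fun x => c / 2 * Fintype.card Y ≤ (D x).card
  have hA : c / 2 * Fintype.card X ≤ (A.card : ℝ) := by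
    have hle : ∀ x, ((D x).card : ℝ)
        ≤ c / 2 * Fintype.card Y + (if x ∈ A then (Fintype.card Y : ℝ) else 0) := by
      intro x
      by_cases hx : x ∈ A
      · have h : ((D x).card : ℝ) ≤ Fintype.card Y := by exact_mod_cast Finset.card_le_univ _
        rw [if_pos hx]
        have := mul_pos hc hY
        linarith
      · have h : ¬ c / 2 * Fintype.card Y ≤ ((D x).card : ℝ) := by simpa [A] using hx
        rw [if_neg hx]
        linarith
    have h := Finset.sum_le_sum fun x (_ : x ∈ Finset.univ) => hle x
    rw [← hDsum, Finset.sum_add_distrib, Finset.sum_ite_mem, Finset.univ_inter] at h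
    simp only [Finset.sum_const, Finset.card_univ, nsmul_eq_mul] at h
    have h' : c / 2 * Fintype.card X * Fintype.card Y ≤ (A.card : ℝ) * Fintype.card Y := by
      linarith
    exact le_of_mul_le_mul_right h' hY
  have hemb : ∀ x ∈ A, (c / 4 * Fintype.card Y) ^ t
      ≤ ((Finset.univ.filter fun g : ι ↪ Y => ∀ i, R x (g i)).card : ℝ) := by
    intro x hx
    have hx' : c / 2 * Fintype.card Y ≤ ((D x).card : ℝ) := by simpa [A] using hx
    have hinj : Fintype.card (ι ↪ D x)
        ≤ (Finset.univ.filter fun g : ι ↪ Y => ∀ i, R x (g i)).card := by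
      rw [← Finset.card_univ]
      refine Finset.card_le_card_of_injOn
        (fun g => g.trans (Function.Embedding.subtype _)) ?_ ?_
      · intro g _
        simp only [Finset.coe_filter, Finset.mem_univ, true_and, Set.mem_ofPred_eq]
        intro i
        exact (Finset.mem_filter.1 (g i).2).2
      · intro g _ g' _ h
        ext i
        exact congrArg (fun k : ι ↪ Y => k i) h
    have hpow : ((D x).card + 1 - t) ^ t ≤ Fintype.card (ι ↪ D x) := by
      rw [Fintype.card_embedding_eq, Fintype.card_coe, ← ht]
      exact Nat.pow_sub_le_descFactorial _ _
    have hbase : c / 4 * Fintype.card Y ≤ (((D x).card + 1 - t : ℕ) : ℝ) := by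
      have htD : t ≤ (D x).card + 1 := by
        have h : (t : ℝ) ≤ (D x).card + 1 := by linarith
        exact_mod_cast h
      rw [Nat.cast_sub htD]
      push_cast
      linarith
    calc (c / 4 * Fintype.card Y) ^ t ≤ (((D x).card + 1 - t : ℕ) : ℝ) ^ t := by gcongr
      _ ≤ _ := by exact_mod_cast hpow.trans hinj
  -- Pairs of a point and an embedding into its neighborhood are counted in two ways; there are at
  -- most |Y| ^ t embeddings, so some embedding has many common neighbors.
  by_contra! hcon
  have hswap : ∑ x : X, ((Finset.univ.filter fun g : ι ↪ Y => ∀ i, R x (g i)).card : ℝ)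
      = ∑ g : ι ↪ Y, (Nat.card {x : X // ∀ i, R x (g i)} : ℝ) := by
    simp only [Nat.card_eq_fintype_card, Fintype.card_subtype, Finset.card_filter]
    push_cast
    exact Finset.sum_comm
  have hlow : (A.card : ℝ) * (c / 4 * Fintype.card Y) ^ t
      ≤ ∑ x : X, ((Finset.univ.filter fun g : ι ↪ Y => ∀ i, R x (g i)).card : ℝ) := by
    rw [← nsmul_eq_mul, ← Finset.sum_const]
    exact (Finset.sum_le_sum hemb).trans
      (Finset.sum_le_sum_of_subset_of_nonneg (Finset.subset_univ _) fun _ _ _ => by positivity)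
  have hE : Nonempty (ι ↪ Y) :=
    Function.Embedding.nonempty_of_card_le ((Nat.le_succ t).trans ((le_max_left _ _).trans hN))
  have hlt : ∑ g : ι ↪ Y, (Nat.card {x : X // ∀ i, R x (g i)} : ℝ)
      < ∑ g : ι ↪ Y, c / 2 * (c / 4) ^ t * Fintype.card X :=
    Finset.sum_lt_sum_of_nonempty Finset.univ_nonempty fun g _ => hcon g
  have hcardE : (Fintype.card (ι ↪ Y) : ℝ) ≤ (Fintype.card Y : ℝ) ^ t := by
    rw [Fintype.card_embedding_eq]
    exact_mod_cast Nat.descFactorial_le_pow _ _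
  rw [Finset.sum_const, Finset.card_univ, nsmul_eq_mul, ← hswap] at hlt
  have h1 : (Fintype.card (ι ↪ Y) : ℝ) * (c / 2 * (c / 4) ^ t * Fintype.card X)
      ≤ (Fintype.card Y : ℝ) ^ t * (c / 2 * (c / 4) ^ t * Fintype.card X) := by gcongr
  have h2 : c / 2 * Fintype.card X * (c / 4 * Fintype.card Y) ^ t
      ≤ A.card * (c / 4 * Fintype.card Y) ^ t := by gcongr
  rw [mul_pow] at h2 hlow
  nlinarith

namespace TwoColoredGraph

/-! ### The extremal bound for grid-free graphs. -/

section pattern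

variable {V : Type*} (G : TwoColoredGraph V)

/-- Four vertices carrying the two complete bipartite graphs of a 2-by-2 grid: the red one
separates `a, b` from `c, d`, the blue one separates `a, c` from `b, d`. -/
def IsGrid (a b c d : V) : Prop :=
  (G.red.Adj a c ∧ G.red.Adj a d ∧ G.red.Adj b c ∧ G.red.Adj b d) ∧
    (G.blue.Adj a b ∧ G.blue.Adj a d ∧ G.blue.Adj c b ∧ G.blue.Adj c d)

theorem adj_of_one_lt_weight {u v : V} (h : 1 < G.weight u v) :
    G.red.Adj u v ∧ G.blue.Adj u v := by
  unfold weight at h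
  split_ifs at h with h1 h2 h2 <;> first | exact ⟨h1, h2⟩ | norm_num at h

theorem weight_le_one {u v : V} (h : ¬ (G.red.Adj u v ∧ G.blue.Adj u v)) : G.weight u v ≤ 1 :=
  not_lt.1 fun h' => h (G.adj_of_one_lt_weight h')

/-- Weight 5 or more means that at most one of the six possible colored edges from `w` to the
triangle is missing. A grid at `w` does without red to its second vertex and blue to its third, so
the three rotations of the triangle cover every case. -/
theorem weight_add_weight_add_weight_le {w x y z : V}
    (hG : ∀ a b c d, ¬ G.IsGrid a b c d)
    (hxy : G.red.Adj x y ∧ G.blue.Adj x y) (hxz : G.red.Adj x z ∧ G.blue.Adj x z)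
    (hyz : G.red.Adj y z ∧ G.blue.Adj y z) :
    G.weight w x + G.weight w y + G.weight w z ≤ 4 := by
  have h1 := hG w x y z
  have h2 := hG w y z x
  have h3 := hG w z x y
  have := hxy.1.symm
  have := hxy.2.symm
  have := hxz.1.symm
  have := hxz.2.symm
  have := hyz.1.symm
  have := hyz.2.symm
  simp only [IsGrid, *, and_true] at h1 h2 h3
  unfold weight
  split_ifs <;> first | (exfalso; simp_all; done) | norm_num

theorem sum_weight_eq_sdiff [DecidableEq V] {s Q : Finset V} (hQ : Q ⊆ s) :
    ∑ u ∈ s, ∑ v ∈ s, G.weight u v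
      = ∑ u ∈ s \ Q, ∑ v ∈ s \ Q, G.weight u v + 2 * ∑ u ∈ s \ Q, ∑ v ∈ Q, G.weight u v
        + ∑ u ∈ Q, ∑ v ∈ Q, G.weight u v := by
  have h : ∀ u, ∑ v ∈ s, G.weight u v = ∑ v ∈ s \ Q, G.weight u v + ∑ v ∈ Q, G.weight u v :=
    fun u => (Finset.sum_sdiff hQ).symm
  have hswap : ∑ u ∈ Q, ∑ v ∈ s \ Q, G.weight u v = ∑ u ∈ s \ Q, ∑ v ∈ Q, G.weight u v := by
    rw [Finset.sum_comm]
    simp only [G.weight_comm]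
  rw [← Finset.sum_sdiff hQ]
  simp only [h, Finset.sum_add_distrib, hswap]
  ring

theorem sum_weight_le_of_subset [DecidableEq V] {s Q : Finset V} (hQ : Q ⊆ s) {b : ℝ}
    (hb : ∀ u ∈ s \ Q, ∑ v ∈ Q, G.weight u v ≤ b) :
    ∑ u ∈ s, ∑ v ∈ s, G.weight u v
      ≤ ∑ u ∈ s \ Q, ∑ v ∈ s \ Q, G.weight u v + 2 * (b * ((s.card : ℝ) - Q.card))
        + 2 * ((Q.card : ℝ) ^ 2 - Q.card) := by
  rw [G.sum_weight_eq_sdiff hQ]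
  have h1 : ∑ u ∈ s \ Q, ∑ v ∈ Q, G.weight u v ≤ b * ((s.card : ℝ) - Q.card) := by
    refine (Finset.sum_le_sum hb).trans (le_of_eq ?_)
    rw [Finset.sum_const, nsmul_eq_mul, Finset.card_sdiff_of_subset hQ,
      Nat.cast_sub (Finset.card_le_card hQ), mul_comm]
  have h2 : ∑ u ∈ Q, ∑ v ∈ Q, G.weight u v ≤ 2 * ((Q.card : ℝ) ^ 2 - Q.card) := by
    have h : ∀ u ∈ Q, ∑ v ∈ Q, G.weight u v ≤ 2 * (Q.card : ℝ) - 2 := by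
      intro u hu
      rw [← Finset.sum_erase_add _ _ hu, weight_self, add_zero]
      refine (Finset.sum_le_sum fun v _ => G.weight_le_two u v).trans (le_of_eq ?_)
      rw [Finset.sum_const, nsmul_eq_mul, Finset.card_erase_of_mem hu,
        Nat.cast_sub (Finset.card_pos.2 ⟨u, hu⟩)]
      push_cast
      ring
    refine (Finset.sum_le_sum h).trans (le_of_eq ?_)
    rw [Finset.sum_const, nsmul_eq_mul]
    ring
  linarith

/-- A 2-colored graph without a grid has at most `3 / 4 * n ^ 2` edges. -/
theorem sum_weight_le_of_forall_not_isGrid (hG : ∀ a b c d, ¬ G.IsGrid a b c d) (s : Finset V) :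
    ∑ u ∈ s, ∑ v ∈ s, G.weight u v ≤ 3 / 2 * (s.card : ℝ) ^ 2 := by
  classical
  induction s using Finset.strongInduction with
  | H s ih =>
  -- Deleting `Q` suits the induction when outside vertices send weight at most 3/2 * |Q| to it: 4
  -- for a triangle of double edges, 3 for a double edge in no such triangle.
  have hremove : ∀ Q ⊆ s, Q.Nonempty → ∀ b : ℝ, (∀ u ∈ s \ Q, ∑ v ∈ Q, G.weight u v ≤ b) →
      ∑ u ∈ s, ∑ v ∈ s, G.weight u v
        ≤ 3 / 2 * ((s.card : ℝ) - Q.card) ^ 2 + 2 * (b * ((s.card : ℝ) - Q.card))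
          + 2 * ((Q.card : ℝ) ^ 2 - Q.card) := by
    intro Q hQ hne b hb
    have h := ih (s \ Q) (Finset.sdiff_ssubset hQ hne)
    rw [Finset.card_sdiff_of_subset hQ, Nat.cast_sub (Finset.card_le_card hQ)] at h
    linarith [G.sum_weight_le_of_subset hQ hb]
  by_cases hdouble : ∃ x ∈ s, ∃ y ∈ s, G.red.Adj x y ∧ G.blue.Adj x y
  · obtain ⟨x, hx, y, hy, hxy⟩ := hdouble
    have hne : x ≠ y := hxy.1.ne
    by_cases htri : ∃ z ∈ s, (G.red.Adj x z ∧ G.blue.Adj x z) ∧ (G.red.Adj y z ∧ G.blue.Adj y z)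
    · obtain ⟨z, hz, hxz, hyz⟩ := htri
      have hxz' : x ≠ z := hxz.1.ne
      have hyz' : y ≠ z := hyz.1.ne
      have hsub : {x, y, z} ⊆ s := by
        intro a ha
        simp only [Finset.mem_insert, Finset.mem_singleton] at ha
        rcases ha with rfl | rfl | rfl <;> assumption
      have hcard : ({x, y, z} : Finset V).card = 3 := Finset.card_eq_three.2
        ⟨x, y, z, hne, hxz', hyz', rfl⟩
      have h := hremove {x, y, z} hsub ⟨x, by simp⟩ 4 fun u _ => by
        rw [Finset.sum_insert (by simp [hne, hxz']), Finset.sum_pair hyz', ← add_assoc]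
        exact G.weight_add_weight_add_weight_le hG hxy hxz hyz
      have h3 : (3 : ℝ) ≤ s.card := by exact_mod_cast hcard ▸ Finset.card_le_card hsub
      rw [hcard] at h
      push_cast at h
      nlinarith
    · have hsub : {x, y} ⊆ s := by
        intro a ha
        simp only [Finset.mem_insert, Finset.mem_singleton] at ha
        rcases ha with rfl | rfl <;> assumption
      have hcard : ({x, y} : Finset V).card = 2 := Finset.card_pair hne
      have h := hremove {x, y} hsub ⟨x, by simp⟩ 3 fun u hu => by
        rw [Finset.sum_pair hne]
        have hus : u ∈ s := (Finset.mem_sdiff.1 hu).1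
        by_cases hux : G.red.Adj x u ∧ G.blue.Adj x u
        · have := G.weight_le_one fun huy => htri ⟨u, hus, hux, huy⟩
          rw [G.weight_comm] at this
          linarith [G.weight_le_two u x]
        · have := G.weight_le_one hux
          rw [G.weight_comm] at this
          linarith [G.weight_le_two u y]
      rw [hcard] at h
      push_cast at h
      nlinarith
  · push Not at hdouble
    have h : ∀ u ∈ s, ∀ v ∈ s, G.weight u v ≤ 1 := fun u hu v hv =>
      G.weight_le_one fun h => hdouble u hu v hv h.1 h.2
    refine (Finset.sum_le_sum fun u hu => Finset.sum_le_sum (h u hu)).trans ?_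
    simp only [Finset.sum_const, nsmul_eq_mul, mul_one]
    nlinarith [sq_nonneg (s.card : ℝ)]

end pattern

/-! ### Supersaturation: many grids above density 3/2. -/

section supersaturation

open scoped Classical in
/-- Bound on the weight of the pullback of `G` along `φ` in terms of the grids that it has. -/
theorem sum_weight_comp_le {V : Type*} (G : TwoColoredGraph V) {m : ℕ} (φ : Fin m → V) :
    ∑ i, ∑ j, G.weight (φ i) (φ j) ≤ 3 / 2 * (m : ℝ) ^ 2 + 2 * (m : ℝ) ^ 2 *
      ∑ e : Fin 4 ↪ Fin m,
        if G.IsGrid (φ (e 0)) (φ (e 1)) (φ (e 2)) (φ (e 3)) then (1 : ℝ) else 0 := by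
  have hnonneg : ∀ e : Fin 4 ↪ Fin m, (0 : ℝ) ≤
      if G.IsGrid (φ (e 0)) (φ (e 1)) (φ (e 2)) (φ (e 3)) then (1 : ℝ) else 0 := by
    intro e
    split_ifs <;> norm_num
  by_cases hgrid : ∀ a b c d, ¬ (G.comap φ).IsGrid a b c d
  · have h := (G.comap φ).sum_weight_le_of_forall_not_isGrid hgrid Finset.univ
    rw [Finset.card_univ, Fintype.card_fin] at h
    refine h.trans (le_add_of_nonneg_right ?_)
    exact mul_nonneg (by positivity) (Finset.sum_nonneg fun e _ => hnonneg e)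
  · push Not at hgrid
    obtain ⟨a, b, c, d, h⟩ := hgrid
    obtain ⟨⟨hac, had, hbc, hbd⟩, hab, -, -, hcd⟩ := id h
    -- Any two of the four grid vertices are adjacent in some color, hence distinct.
    have hinj : Function.Injective ![a, b, c, d] := by
      have := hac.ne; have := had.ne; have := hbc.ne; have := hbd.ne; have := hab.ne
      have := hcd.ne
      intro i j hij
      fin_cases i <;> fin_cases j <;> simp_all
    have hone : (1 : ℝ) ≤ ∑ e : Fin 4 ↪ Fin m,
        if G.IsGrid (φ (e 0)) (φ (e 1)) (φ (e 2)) (φ (e 3)) then (1 : ℝ) else 0 := by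
      refine le_trans ?_ (Finset.single_le_sum (fun e _ => hnonneg e)
        (Finset.mem_univ ⟨![a, b, c, d], hinj⟩))
      rw [if_pos]
      exact h
    have htriv : ∑ i, ∑ j, G.weight (φ i) (φ j) ≤ 2 * (m : ℝ) ^ 2 := by
      refine (Finset.sum_le_sum fun i _ => Finset.sum_le_sum fun j _ =>
        G.weight_le_two (φ i) (φ j)).trans (le_of_eq ?_)
      simp
      ring
    nlinarith [sq_nonneg (m : ℝ)]

/-- Each of the m ^ 2 - m ordered pairs of distinct indices sees a uniformly random pair of
vertices; equal indices have weight 0. -/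
theorem card_pow_mul_sum_weight_comp {V : Type*} [Fintype V] (G : TwoColoredGraph V) (m : ℕ) :
    (Fintype.card V : ℝ) ^ 2 * ∑ φ : Fin m → V, ∑ i, ∑ j, G.weight (φ i) (φ j)
      = ((m : ℝ) ^ 2 - m) * ((Fintype.card V : ℝ) ^ m * ∑ u, ∑ v, G.weight u v) := by
  classical
  set W := ∑ u, ∑ v, G.weight u v with hW
  have h : ∀ i j : Fin m, (Fintype.card V : ℝ) ^ 2 * ∑ φ : Fin m → V, G.weight (φ i) (φ j)
      = if i = j then 0 else (Fintype.card V : ℝ) ^ m * W := by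
    intro i j
    split_ifs with hij
    · simp [hij]
    · have hinj : Function.Injective ![i, j] := by
        intro a b hab
        have := Ne.symm hij
        fin_cases a <;> fin_cases b <;> simp_all
      have h := Fintype.card_pow_mul_sum_comp (V := V) ⟨![i, j], hinj⟩
        (fun ψ => G.weight (ψ 0) (ψ 1))
      rw [Fintype.card_fin, Fintype.card_fin] at h
      refine h.trans ?_
      have hpair := (finTwoArrowEquiv V).sum_comp (fun p => G.weight p.1 p.2)
      rw [Fintype.sum_prod_type] at hpair
      exact congrArg _ hpair
  have hswap : ∑ φ : Fin m → V, ∑ i, ∑ j, G.weight (φ i) (φ j)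
      = ∑ i, ∑ j, ∑ φ : Fin m → V, G.weight (φ i) (φ j) := by
    rw [Finset.sum_comm]
    exact Finset.sum_congr rfl fun i _ => Finset.sum_comm
  have hmul : (Fintype.card V : ℝ) ^ 2 * ∑ i, ∑ j, ∑ φ : Fin m → V, G.weight (φ i) (φ j)
      = ∑ i, ∑ j, (Fintype.card V : ℝ) ^ 2 * ∑ φ : Fin m → V, G.weight (φ i) (φ j) := by
    rw [Finset.mul_sum]
    exact Finset.sum_congr rfl fun i _ => Finset.mul_sum _ _ _
  rw [hswap, hmul]
  simp only [h]
  have hrow : ∀ i : Fin m, ∑ j : Fin m, (if i = j then 0 else (Fintype.card V : ℝ) ^ m * W)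
      = ((m : ℝ) - 1) * ((Fintype.card V : ℝ) ^ m * W) := by
    intro i
    have h' : ∀ j : Fin m, (if i = j then 0 else (Fintype.card V : ℝ) ^ m * W)
      = (Fintype.card V : ℝ) ^ m * W - if i = j then (Fintype.card V : ℝ) ^ m * W else 0 := by
      intro j
      split_ifs <;> ring
    simp only [h', Finset.sum_sub_distrib, Finset.sum_ite_eq, Finset.mem_univ, if_true]
    simp
    ring
  simp only [hrow]
  simp
  ring

/-- The four vertices of a grid as a nested tuple. -/
def finFourArrowEquiv (V : Type*) : (Fin 4 → V) ≃ ((V × V) × V) × V where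
  toFun ψ := (((ψ 0, ψ 1), ψ 2), ψ 3)
  invFun p := ![p.1.1.1, p.1.1.2, p.1.2, p.2]
  left_inv ψ := by
    ext i
    fin_cases i <;> rfl
  right_inv _ := rfl

/-- A 2-colored graph of density more than `3 / 2` has a positive proportion of grids. -/
theorem exists_mul_pow_le_card_isGrid {ε : ℝ} (hε : 0 < ε) :
    ∃ c : ℝ, 0 < c ∧ ∀ (V : Type) [Fintype V] (G : TwoColoredGraph V),
      (3 / 2 + ε) * (Fintype.card V : ℝ) ^ 2 ≤ ∑ u, ∑ v, G.weight u v →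
      c * (Fintype.card V : ℝ) ^ 4
        ≤ (Nat.card {p : ((V × V) × V) × V // G.IsGrid p.1.1.1 p.1.1.2 p.1.2 p.2} : ℝ) := by
  classical
  -- Sampling loses a factor 1 - 1/m; this `m` keeps the average weight above (3/2 + ε/2) * m ^ 2,
  -- still beyond the grid-free bound.
  obtain ⟨m, hm⟩ := exists_nat_gt ((3 + 2 * ε) / ε)
  have hm0 : (0 : ℝ) < m := lt_trans (by positivity) hm
  rw [div_lt_iff₀ hε] at hm
  set E : ℝ := ((Fintype.card (Fin 4 ↪ Fin m) : ℕ) : ℝ) with hE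
  have hE0 : 0 ≤ E := Nat.cast_nonneg _
  refine ⟨ε / (4 * (E + 1)), by positivity, ?_⟩
  intro V _ G hG
  set n : ℝ := (Fintype.card V : ℝ) with hn
  set S : ℝ :=
    (Nat.card {p : ((V × V) × V) × V // G.IsGrid p.1.1.1 p.1.1.2 p.1.2 p.2} : ℝ) with hS
  have hS0 : 0 ≤ S := Nat.cast_nonneg _
  rcases (Nat.cast_nonneg (Fintype.card V) : (0 : ℝ) ≤ Fintype.card V).eq_or_lt with h0 | h0
  · rw [hn, ← h0]
    simpa using hS0
  have hcount : ∀ e : Fin 4 ↪ Fin m, n ^ 4 * ∑ φ : Fin m → V,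
      (if G.IsGrid (φ (e 0)) (φ (e 1)) (φ (e 2)) (φ (e 3)) then (1 : ℝ) else 0) = n ^ m * S := by
    intro e
    have h := Fintype.card_pow_mul_sum_comp (V := V) e
      (fun ψ => if G.IsGrid (ψ 0) (ψ 1) (ψ 2) (ψ 3) then (1 : ℝ) else 0)
    rw [Fintype.card_fin, Fintype.card_fin] at h
    refine h.trans ?_
    have htuple := (finFourArrowEquiv V).sum_comp
      (fun p => if G.IsGrid p.1.1.1 p.1.1.2 p.1.2 p.2 then (1 : ℝ) else 0)
    have hcard : ∑ p : ((V × V) × V) × V,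
        (if G.IsGrid p.1.1.1 p.1.1.2 p.1.2 p.2 then (1 : ℝ) else 0) = S := by
      rw [Finset.sum_boole, ← Fintype.card_subtype, ← Nat.card_eq_fintype_card]
    exact congrArg _ (htuple.trans hcard)
  have hsum : ∑ φ : Fin m → V, ∑ i, ∑ j, G.weight (φ i) (φ j)
      ≤ n ^ m * (3 / 2 * (m : ℝ) ^ 2) + 2 * (m : ℝ) ^ 2 *
        ∑ e : Fin 4 ↪ Fin m, ∑ φ : Fin m → V,
          (if G.IsGrid (φ (e 0)) (φ (e 1)) (φ (e 2)) (φ (e 3)) then (1 : ℝ) else 0) := by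
    refine (Finset.sum_le_sum fun φ _ => G.sum_weight_comp_le φ).trans (le_of_eq ?_)
    rw [Finset.sum_add_distrib, ← Finset.mul_sum Finset.univ _ (2 * (m : ℝ) ^ 2), Finset.sum_comm,
      Finset.sum_const, Finset.card_univ, Fintype.card_fun, Fintype.card_fin, nsmul_eq_mul,
      Nat.cast_pow]
  have htotal := mul_le_mul_of_nonneg_left hsum (by positivity : (0 : ℝ) ≤ n ^ 4)
  have hlhs : n ^ 4 * ∑ φ : Fin m → V, ∑ i, ∑ j, G.weight (φ i) (φ j)
      = n ^ m * (n ^ 2 * (((m : ℝ) ^ 2 - m) * ∑ u, ∑ v, G.weight u v)) := by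
    have h := G.card_pow_mul_sum_weight_comp m
    calc n ^ 4 * ∑ φ : Fin m → V, ∑ i, ∑ j, G.weight (φ i) (φ j)
        = n ^ 2 * (n ^ 2 * ∑ φ : Fin m → V, ∑ i, ∑ j, G.weight (φ i) (φ j)) := by ring
      _ = _ := by rw [h]; ring
  have hrhs : n ^ 4 * (n ^ m * (3 / 2 * (m : ℝ) ^ 2) + 2 * (m : ℝ) ^ 2 *
      ∑ e : Fin 4 ↪ Fin m, ∑ φ : Fin m → V,
        (if G.IsGrid (φ (e 0)) (φ (e 1)) (φ (e 2)) (φ (e 3)) then (1 : ℝ) else 0))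
      = n ^ m * (3 / 2 * (m : ℝ) ^ 2 * n ^ 4 + 2 * (m : ℝ) ^ 2 * (E * S)) := by
    have h : n ^ 4 * ∑ e : Fin 4 ↪ Fin m, ∑ φ : Fin m → V,
        (if G.IsGrid (φ (e 0)) (φ (e 1)) (φ (e 2)) (φ (e 3)) then (1 : ℝ) else 0)
        = E * (n ^ m * S) := by
      rw [Finset.mul_sum]
      simp only [hcount]
      rw [Finset.sum_const, Finset.card_univ, nsmul_eq_mul]
    linear_combination (2 * (m : ℝ) ^ 2) * h
  rw [hlhs, hrhs] at htotal
  have hred := le_of_mul_le_mul_left htotal (by positivity)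
  have hmm : (m : ℝ) ^ 2 * (3 / 2 + ε / 2) ≤ ((m : ℝ) ^ 2 - m) * (3 / 2 + ε) := by nlinarith
  have hmm0 : 0 ≤ (m : ℝ) ^ 2 - m := by
    by_contra! hneg
    nlinarith [sq_nonneg (m : ℝ)]
  have h1 : (m : ℝ) ^ 2 * (3 / 2 + ε / 2) * n ^ 4
      ≤ n ^ 2 * (((m : ℝ) ^ 2 - m) * ∑ u, ∑ v, G.weight u v) :=
    calc (m : ℝ) ^ 2 * (3 / 2 + ε / 2) * n ^ 4
        ≤ ((m : ℝ) ^ 2 - m) * (3 / 2 + ε) * n ^ 4 := by gcongr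
      _ = n ^ 2 * (((m : ℝ) ^ 2 - m) * ((3 / 2 + ε) * n ^ 2)) := by ring
      _ ≤ _ := by gcongr
  have h2 : (m : ℝ) ^ 2 * (ε * n ^ 4) ≤ (m : ℝ) ^ 2 * (4 * (E * S)) := by linarith
  have h3 : ε * n ^ 4 ≤ 4 * (E * S) := le_of_mul_le_mul_left h2 (by positivity)
  rw [div_mul_eq_mul_div, div_le_iff₀ (by positivity)]
  nlinarith

end supersaturation

/-! ### Blow-ups of the grid and the upper bound. -/

section upper

/-- A dense enough large 2-colored graph contains blow-ups of the grid. -/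
theorem exists_embedding_isGrid {ι : Type*} [Fintype ι] {ε : ℝ} (hε : 0 < ε) :
    ∃ N : ℕ, ∀ (V : Type) [Fintype V] (G : TwoColoredGraph V), N ≤ Fintype.card V →
      (3 / 2 + ε) * (Fintype.card V : ℝ) ^ 2 ≤ ∑ u, ∑ v, G.weight u v →
      ∃ a b c d : ι ↪ V, ∀ i j k l, G.IsGrid (a i) (b j) (c k) (d l) := by
  classical
  obtain ⟨c₄, hc₄, hgrid⟩ := exists_mul_pow_le_card_isGrid hε
  obtain ⟨c₃, hc₃, N₃, h₃⟩ := exists_embedding_forall_of_dense (ι := ι) hc₄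
  obtain ⟨c₂, hc₂, N₂, h₂⟩ := exists_embedding_forall_of_dense (ι := ι) hc₃
  obtain ⟨c₁, hc₁, N₁, h₁⟩ := exists_embedding_forall_of_dense (ι := ι) hc₂
  refine ⟨max (max N₃ N₂) (max N₁ ⌈Fintype.card ι / c₁⌉₊), ?_⟩
  intro V _ G hN hG
  simp only [max_le_iff] at hN
  obtain ⟨⟨hN₃, hN₂⟩, hN₁, hN₀⟩ := hN
  -- Each application blows up the last coordinate and leaves a dense set of shorter tuples; the
  -- final set of vertices is large enough to hold `a`.
  obtain ⟨d, hd⟩ := h₃ ((V × V) × V) V (fun p x => G.IsGrid p.1.1 p.1.2 p.2 x) hN₃ (by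
    refine le_trans (le_of_eq ?_) (hgrid V G hG)
    simp only [Fintype.card_prod]
    push_cast
    ring)
  obtain ⟨c, hc⟩ := h₂ (V × V) V (fun p x => ∀ l, G.IsGrid p.1 p.2 x (d l)) hN₂ (by
    refine le_trans (le_of_eq ?_) hd
    simp only [Fintype.card_prod]
    push_cast
    ring)
  obtain ⟨b, hb⟩ := h₁ V V (fun p x => ∀ k l, G.IsGrid p x (c k) (d l)) hN₁ (by
    refine le_trans (le_of_eq ?_) hc
    simp only [Fintype.card_prod]
    push_cast
    ring)
  rw [Nat.card_eq_fintype_card] at hb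
  have hcard : Fintype.card ι ≤ Fintype.card {p : V // ∀ j k l, G.IsGrid p (b j) (c k) (d l)} := by
    have h := (Nat.le_ceil _).trans (Nat.cast_le (α := ℝ).2 hN₀)
    rw [div_le_iff₀ hc₁] at h
    have h' := h.trans ((mul_comm _ _).le.trans hb)
    exact_mod_cast h'
  obtain ⟨a⟩ := Function.Embedding.nonempty_of_card_le hcard
  exact ⟨a.trans (Function.Embedding.subtype _), b, c, d, fun i => (a i).2⟩

variable {V : Type*} {H : TwoColoredGraph V}

/-- A bipartite 2-colored graph is contained in the blow-ups of the grid. -/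
theorem IsBipartite.isContained (hH : H.IsBipartite) {W : Type*} {G : TwoColoredGraph W}
    {a b c d : V ↪ W} (h : ∀ i j k l, G.IsGrid (a i) (b j) (c k) (d l)) : H.IsContained G := by
  let r : H.red.Coloring Bool :=
    (SimpleGraph.colorable_two_of_forall_isCycle_not_odd hH.1).toColoring (by simp)
  let s : H.blue.Coloring Bool :=
    (SimpleGraph.colorable_two_of_forall_isCycle_not_odd hH.2).toColoring (by simp)
  -- The red color chooses between {a, b} and {c, d}, the blue color between {a, c} and {b, d}.
  let f : V → W := fun v =>
    if r v then (if s v then d v else c v) else (if s v then b v else a v)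
  have hac : ∀ i j, G.red.Adj (a i) (c j) := fun i j => (h i i j j).1.1
  have had : ∀ i j, G.red.Adj (a i) (d j) := fun i j => (h i i j j).1.2.1
  have hbc : ∀ i j, G.red.Adj (b i) (c j) := fun i j => (h i i j j).1.2.2.1
  have hbd : ∀ i j, G.red.Adj (b i) (d j) := fun i j => (h i i j j).1.2.2.2
  have hab' : ∀ i j, G.blue.Adj (a i) (b j) := fun i j => (h i j j j).2.1
  have had' : ∀ i j, G.blue.Adj (a i) (d j) := fun i j => (h i i j j).2.2.1
  have hcb' : ∀ i j, G.blue.Adj (c i) (b j) := fun i j => (h i j i j).2.2.2.1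
  have hcd' : ∀ i j, G.blue.Adj (c i) (d j) := fun i j => (h i i i j).2.2.2.2
  have hr : ∀ u v, H.red.Adj u v → G.red.Adj (f u) (f v) := by
    intro u v huv
    have := r.valid huv
    simp only [f]
    split_ifs <;> first
      | (exfalso; simp_all; done)
      | exact hac _ _
      | exact (hac _ _).symm
      | exact had _ _
      | exact (had _ _).symm
      | exact hbc _ _
      | exact (hbc _ _).symm
      | exact hbd _ _
      | exact (hbd _ _).symm
  have hb : ∀ u v, H.blue.Adj u v → G.blue.Adj (f u) (f v) := by
    intro u v huv
    have := s.valid huv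
    simp only [f]
    split_ifs <;> first
      | (exfalso; simp_all; done)
      | exact hab' _ _
      | exact (hab' _ _).symm
      | exact had' _ _
      | exact (had' _ _).symm
      | exact hcb' _ _
      | exact (hcb' _ _).symm
      | exact hcd' _ _
      | exact (hcd' _ _).symm
  refine ⟨⟨f, fun u v huv => ?_⟩, hr, hb⟩
  simp only [f] at huv
  have hcases : ∀ i j, a i ≠ b j ∧ a i ≠ c j ∧ a i ≠ d j ∧ b i ≠ c j ∧ b i ≠ d j ∧ c i ≠ d j :=
    fun i j => ⟨(hab' i j).ne, (hac i j).ne, (had i j).ne, (hbc i j).ne, (hbd i j).ne,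
      (hcd' i j).ne⟩
  have huv1 := hcases u v
  have huv2 := hcases v u
  split_ifs at huv <;> first
    | exact Function.Embedding.injective _ huv
    | (exfalso; simp_all)

theorem IsBipartite.turanDensity_le [Finite V] (hH : H.IsBipartite) : H.turanDensity ≤ 3 / 2 := by
  have := Fintype.ofFinite V
  by_contra! hlt
  obtain ⟨ε, hε, hH'⟩ : ∃ ε : ℝ, 0 < ε ∧ 3 / 2 + 2 * ε < H.turanDensity :=
    ⟨(H.turanDensity - 3 / 2) / 4, by linarith, by linarith⟩
  obtain ⟨N, hN⟩ := exists_embedding_isGrid (ι := V) hε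
  -- Density is relative to n * (n - 1), the blow-up lemma to n ^ 2; for n ≥ `M` the second ε
  -- absorbs the difference.
  obtain ⟨M, hM⟩ := exists_nat_gt ((3 / 2 + 2 * ε) / ε)
  rw [div_lt_iff₀ hε] at hM
  obtain ⟨n, hnN, hnM, hn2⟩ : ∃ n : ℕ, N ≤ n ∧ M ≤ n ∧ 2 ≤ n :=
    ⟨N + M + 2, by omega, by omega, by omega⟩
  have hn2' : (2 : ℝ) ≤ n := by exact_mod_cast hn2
  have hnM' : (M : ℝ) ≤ n := by exact_mod_cast hnM
  obtain ⟨G, hG, hdens⟩ := H.exists_lt_edgeDensity (by positivity)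
    (hH'.trans_le (H.turanDensity_le_turanDensityAt hn2))
  rw [edgeDensity_eq_sum_weight, Fintype.card_fin, lt_div_iff₀ (by nlinarith)] at hdens
  have hnε : 3 / 2 + 2 * ε ≤ n * ε := by nlinarith
  obtain ⟨a, b, c, d, h⟩ := hN (Fin n) G (by simpa using hnN) (by
    rw [Fintype.card_fin]
    nlinarith)
  exact hG (hH.isContained h)

end upper

end TwoColoredGraph

theorem lemma3p1 {V : Type*} [Finite V] (H : TwoColoredGraph V)
    (hH : ∃ u v : V, H.red.Adj u v ∨ H.blue.Adj u v) :
    Filter.Tendsto H.turanDensityAt Filter.atTop (nhds H.turanDensity) ∧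
      (¬ H.IsBipartite → 3 / 2 ≤ H.turanDensity) ∧
      (H.IsBipartite → H.turanDensity ≤ 3 / 2) := by
  exact ⟨H.tendsto_turanDensityAt, H.three_halves_le_turanDensity, fun h => h.turanDensity_le⟩
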